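/- **Theorem 3.1.** Setting. Let $E$ be a finite-dimensional complex Hilbert space, $N=\dim E$, let $g=P_+-P_-$ with $P_\pm$ complementary orthogonal projections, and put $[x,y]=\langle gx,y\rangle$ (antilinear in the first variable). Let $\mathbf B$ be a Hermitian operator on $E$ commuting with $g$, with simple real eigenvalues $\lambda_1,\dots,\lambda_N$ and orthonormal eigenvectors $e_1,\dots,e_N$, and let $e\in E$ with $[e,e]=1$. Write $e^s=\langle e_s,e\rangle$ and $g_{ss}=[e_s,e_s]$. Inner channel. Let $\mathbf B_0$ be the restriction of $\mathbf B$ to $D_0=(\mathbf B-i)^{-1}\{v:[v,e]=0\}$ and $\mathbf B_0^+$ its adjoint with respect to $[\cdot,\cdot]$, i.e. the linear relation of all pairs $(y,z)$ with $[\mathbf B x,y]=[x,z]$ for all $x\in D_0$. With $e'=(\mathbf B+i)(\mathbf B-i)^{-1}e$, $w_+=\frac{e+e'}2$, $w_-=\frac{e-e'}{2i}$, the symplectic coordinates $\xi_\pm$ of such a pair are given by $y=x_0+\xi_+w_++\xi_-w_-$, $z=\mathbf Bx_0+\xi_+w_--\xi_-w_+$, $x_0\in D_0$. Outer channel. Let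 $l_0^+$ be the adjoint in $L_2(\mathbb R^3)$ of $-\Delta$ restricted to $C_c^\infty(\mathbb R^3\setminus\{0\})$, and let $A,B$ be the boundary values in $u(x)=\frac{A}{4\pi|x|}+B+o(1)$ as $x\to0$. For a Hermitian matrix $\Gamma=\begin{pmatrix}\gamma_{00}&\gamma_{01}\\ \gamma_{10}&\gamma_{11}\end{pmatrix}$ let $\mathcal A$ be the restriction of $l_0^+\oplus\mathbf B_0^+$ by the boundary condition $$\begin{pmatrix}B\\-\xi_-\end{pmatrix}=\Gamma\begin{pmatrix}A\\ \xi_+\end{pmatrix}.$$ For $\lambda>0$ different from all $\lambda_s$ and a unit vector $\nu\in\mathbb R^3$, numbers $T,T_E\in\mathbb C$ are called amplitudes if the pair $$\psi(x)=e^{i\sqrt\lambda\,\langle\nu,x\rangle}+T\,\frac{e^{i\sqrt\lambda|x|}}{4\pi|x|},\qquad \psi_E=T_E\,(\mathbf B+i)(\mathbf B-\lambda)^{-1}e$$ is a generalized eigenfunction of $\mathcal A$ at $\lambda$, i.e. for every $\chi\in C_c^\infty(\mathbb R^3)$ that is real-valued and equal to $1$ near $0$, the pair $(\chi\psi,\psi_E)$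 lies in the domain of $\mathcal A$ and is sent to a pair $(f,\lambda\psi_E)$ with $f=\lambda\psi$ almost everywhere on the interior of $\{\chi=1\}$. Claim. Let $\lambda>0$, $\lambda\ne\lambda_s$ for all $s$. The Krein $Q$-function $Q(\lambda)=\left[e,\frac{I+\lambda\mathbf B}{\mathbf B-\lambda I}\,e\right]$ equals $$Q(\lambda)=\sum_{s=1}^N\frac{1+\lambda\lambda_s}{\lambda_s-\lambda}\,|e^s|^2g_{ss}.$$ If moreover $Q(\lambda)\neq\gamma_{11}$, then for every unit vector $\nu$ the amplitudes exist, are unique, do not depend on $\nu$, and are $$T=\frac1{\gamma_{00}-\dfrac{|\gamma_{01}|^2}{\gamma_{11}-Q(\lambda)}-\dfrac{i\sqrt\lambda}{4\pi}},\qquad T_E=\frac{\gamma_{10}}{Q(\lambda)-\gamma_{11}}\,T .$$ -/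

import Mathlib

open scoped ContDiff Topology Laplacian ComplexConjugate
open MeasureTheory Filter

noncomputable section

/-- The three-dimensional Euclidean space of the outer channel. -/
abbrev R3 : Type := EuclideanSpace ℝ (Fin 3)

/-! ### The outer channel -/

/-- The domain of the restricted outer operator `-Δ`: smooth compactly supported functions
that vanish near the origin. -/
def IsOuterTest (φ : R3 → ℂ) : Prop :=
  ContDiff ℝ ∞ φ ∧ HasCompactSupport φ ∧ (0 : R3) ∉ tsupport φ

/-- The graph of the adjoint in `L²(ℝ³)` of the restricted outer operator: `u` is in its domain
and is sent to `f` when `u, f ∈ L²` and `⟨-Δφ, u⟩ = ⟨φ, f⟩` for all `φ` in the domain of the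
restricted operator. (An operator and its closure have the same adjoint.) -/
def OuterAdjoint (u f : R3 → ℂ) : Prop :=
  MemLp u 2 (volume : Measure R3) ∧ MemLp f 2 (volume : Measure R3) ∧
    ∀ φ : R3 → ℂ, IsOuterTest φ →
      ∫ x, conj (-(Δ φ x)) * u x = ∫ x, conj (φ x) * f x

/-- The asymptotic boundary values at the origin: `u(x) = A / (4π|x|) + b + o(1)` as `x → 0`.
As `u` stands for its class in `L²`, the limit is taken up to a null set. -/
def HasOuterBoundaryValues (u : R3 → ℂ) (A b : ℂ) : Prop :=
  Tendsto (fun x : R3 => u x - A / (4 * Real.pi * ‖x‖ : ℝ)) (𝓝 0 ⊓ ae volume) (𝓝 b)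

/-! ### The inner channel -/

section Metric

variable {E : Type*} [NormedAddCommGroup E] [InnerProductSpace ℂ E] [FiniteDimensional ℂ E]

/-- The metric operator `g = P₊ - P₋`, where `P₊` and `P₋` are the orthogonal projections onto
a subspace and onto its orthogonal complement. -/
def metricOp (Eplus : Submodule ℂ E) : E →ₗ[ℂ] E :=
  (Eplus.starProjection - Eplusᗮ.starProjection : E →L[ℂ] E)

/-- The indefinite product `[x, y] = ⟨g x, y⟩`, antilinear in the first variable. -/
def gProd (Eplus : Submodule ℂ E) (x y : E) : ℂ :=
  inner ℂ (metricOp Eplus x) y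

end Metric

/-- The inner channel: an indefinite metric `g = P₊ - P₋` on a finite-dimensional Hilbert space,
a Hermitian operator `B` commuting with `g`, and a deficiency vector `e` with `[e, e] = 1`. -/
structure InnerModel (E : Type*) [NormedAddCommGroup E] [InnerProductSpace ℂ E]
    [FiniteDimensional ℂ E] where
  Eplus : Submodule ℂ E
  B : E →ₗ[ℂ] E
  symm : B.IsSymmetric
  comm : Commute B (metricOp Eplus)
  e : E
  e_norm : gProd Eplus e e = 1

namespace InnerModel

variable {E : Type*} [NormedAddCommGroup E] [InnerProductSpace ℂ E] [FiniteDimensional ℂ E]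
variable (M : InnerModel E)

/-- The indefinite product of the inner space. -/
def ip (x y : E) : ℂ := gProd M.Eplus x y

/-- `(B - z)⁻¹`, meaningful whenever `z` is not an eigenvalue of `B`. -/
def invSub (z : ℂ) : Module.End ℂ E := Ring.inverse (M.B - z • (1 : Module.End ℂ E))

/-- The domain `(B - i)⁻¹ (E ⊖ {e})` of the restricted inner operator `B₀`, the orthogonal
difference being taken with respect to the indefinite product. -/
def restrictedDomain : Set E :=
  {x | ∃ v : E, M.ip v M.e = 0 ∧ x = M.invSub Complex.I v}

/-- The deficiency vector `e' = (B + i)(B - i)⁻¹ e`. -/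
def e' : E := (M.B + Complex.I • (1 : Module.End ℂ E)) (M.invSub Complex.I M.e)

/-- The symplectic basis of the defect: `w₊ = (e + e') / 2`. -/
def wPlus : E := (1 / 2 : ℂ) • (M.e + M.e')

/-- The symplectic basis of the defect: `w₋ = (e - e') / (2i)`. -/
def wMinus : E := (1 / (2 * Complex.I) : ℂ) • (M.e - M.e')

/-- The graph of the adjoint `B₀⁺` with respect to the indefinite product: `y` is sent to `z`
when `[B₀ x, y] = [x, z]` for all `x` in the domain of `B₀`. As `B₀` is not densely defined in
the finite-dimensional space `E`, this is a linear relation. -/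
def InnerAdjoint (y z : E) : Prop :=
  ∀ x ∈ M.restrictedDomain, M.ip (M.B x) y = M.ip x z

/-- The symplectic coordinates `ξ₊, ξ₋` of the element `(y, z)` of the graph of `B₀⁺`:
`y = x₀ + ξ₊ w₊ + ξ₋ w₋` with `x₀` in the domain of `B₀`, and
`z = B₀⁺ y = B x₀ + ξ₊ w₋ - ξ₋ w₊`. -/
def HasInnerCoords (y z : E) (ξp ξm : ℂ) : Prop :=
  ∃ x₀ ∈ M.restrictedDomain,
    y = x₀ + ξp • M.wPlus + ξm • M.wMinus ∧ z = M.B x₀ + ξp • M.wMinus - ξm • M.wPlus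

/-- The Krein `Q`-function `Q(z) = [e, (1 + z B)(B - z)⁻¹ e]`. -/
def Q (z : ℂ) : ℂ :=
  M.ip M.e (((1 : Module.End ℂ E) + z • M.B) (M.invSub z M.e))

/-- The deficiency vector `(B + i)(B - z)⁻¹ e`, which solves `B₀⁺ x = z x`. -/
def deficiencyVector (z : ℂ) : E :=
  (M.B + Complex.I • (1 : Module.End ℂ E)) (M.invSub z M.e)

/-! ### The extension and its scattered waves -/

/-- The graph of the extension `𝒜` of `l₀ ⊕ B₀` in `L²(ℝ³) ⊕ E` defined by the matrix `Γ`: the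
restriction of `l₀⁺ ⊕ B₀⁺` by the boundary condition `(b, -ξ₋) = Γ (A, ξ₊)`. The element
`(u, y)` is sent to `(f, z)`. -/
def Extension (Γ : Matrix (Fin 2) (Fin 2) ℂ) (u : R3 → ℂ) (y : E) (f : R3 → ℂ) (z : E) : Prop :=
  OuterAdjoint u f ∧ M.InnerAdjoint y z ∧
    ∃ A b ξp ξm : ℂ, HasOuterBoundaryValues u A b ∧ M.HasInnerCoords y z ξp ξm ∧
      ![b, -ξm] = Γ.mulVec ![A, ξp]

/-- `(ψ, ψE)` is a generalized eigenfunction of the extension `𝒜` at the spectral point `lam`,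
that is `𝒜 (ψ, ψE) = lam (ψ, ψE)` without `ψ ∈ L²`: whenever the outer component is cut off
by a smooth compactly supported `χ` which is `1` near the origin, the result is in the domain
of `𝒜`, and its image equals `lam (ψ, ψE)` where the cut-off is not felt. -/
def IsGeneralizedEigenfunction (Γ : Matrix (Fin 2) (Fin 2) ℂ) (lam : ℝ)
    (ψ : R3 → ℂ) (ψE : E) : Prop :=
  ∀ χ : R3 → ℝ, ContDiff ℝ ∞ χ → HasCompactSupport χ → (∀ᶠ x in 𝓝 0, χ x = 1) →
    ∃ f : R3 → ℂ,
      M.Extension Γ (fun x => (χ x : ℂ) * ψ x) ψE f ((lam : ℂ) • ψE) ∧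
      ∀ᵐ x : R3, (∀ᶠ x' in 𝓝 x, χ x' = 1) → f x = lam * ψ x

end InnerModel

/-- The outer component of the scattered wave: the plane wave in direction `ν` plus `T` times
the outgoing spherical wave, `exp(i√lam ⟨ν,x⟩) + T exp(i√lam |x|) / (4π|x|)`. -/
def outerWave (lam : ℝ) (ν : R3) (T : ℂ) (x : R3) : ℂ :=
  Complex.exp (Complex.I * (Real.sqrt lam * inner ℝ ν x : ℝ)) +
    T * (Complex.exp (Complex.I * (Real.sqrt lam * ‖x‖ : ℝ)) / (4 * Real.pi * ‖x‖ : ℝ))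

/-- `T` and `TE` are the amplitudes of a scattered wave of the extension defined by `Γ`, at
energy `lam` and with incoming direction `ν`: the pair with outer component the plane wave plus
`T` times the outgoing wave and inner component `TE (B + i)(B - lam)⁻¹ e` is a generalized
eigenfunction of the extension. -/
def InnerModel.AreAmplitudes {E : Type*} [NormedAddCommGroup E] [InnerProductSpace ℂ E]
    [FiniteDimensional ℂ E] (M : InnerModel E) (Γ : Matrix (Fin 2) (Fin 2) ℂ) (lam : ℝ)
    (ν : R3) (T TE : ℂ) : Prop :=
  M.IsGeneralizedEigenfunction Γ lam (outerWave lam ν T) (TE • M.deficiencyVector lam)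

end

/-!
The condition that `(T, TE)` are amplitudes reduces to two linear equations for `T` and `TE`.

In the outer channel, plane and spherical waves solve `-Δw = lam w` on `ℝ³ ∖ {0}`
(`laplacian_planeWave`, `laplacian_sphericalWave`). The cut-off wave `χ w` is in `L²`, since `|x|⁻²`
is locally integrable, and Green's identity against test functions vanishing near the origin puts it
in the domain of the adjoint, with image `-Δ(χ w)` (`exists_outerAdjoint_cutoff`). Its boundary
values are unique and equal to `A = T`, `b = 1 + i√lam T / (4π)` (`HasOuterBoundaryValues.unique`,
`hasOuterBoundaryValues_outerWave`).

In the inner channel, with `u = (B - i)⁻¹ e` the symplectic basis is `w₊ = B u`, `w₋ = -u`. From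
this the pair `(y, lam y)`, `y = TE (B + i)(B - lam)⁻¹ e`, lies in the graph of `B₀⁺` and has exactly
one pair of symplectic coordinates, `ξ₊ = TE`, `ξ₋ = -TE Q(lam)`
(`InnerModel.hasInnerCoords_deficiencyVector`, `InnerModel.innerAdjoint_deficiencyVector`).

The boundary condition therefore says `1 + i√lam T / (4π) = γ₀₀ T + γ₀₁ TE` and
`TE Q = γ₁₀ T + γ₁₁ TE` (`InnerModel.areAmplitudes_iff`). For `Q ≠ γ₁₁` the second equation gives
`TE`, and the first one becomes `T D = 1`, `D` being the
denominator in the formula for `T`. It never vanishes: `Q(lam)` is real by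
the spectral formula (`InnerModel.Q_eq_sum`), so `D` has imaginary part `-√lam / (4π)`.
-/

/-! ### The Helmholtz equation for plane and spherical waves -/

/-- Chain rule for the Laplacian of `h ∘ p` with `h` a function of one real variable:
`Δ (h ∘ p) = (h'' ∘ p) |∇p|² + (h' ∘ p) Δp`. -/
theorem laplacian_comp_eq_sum {V : Type*} [NormedAddCommGroup V] [InnerProductSpace ℝ V]
    [FiniteDimensional ℝ V] {ι : Type*} [Fintype ι] (v : OrthonormalBasis ι ℝ V)
    {p : V → ℝ} {p' : V → V →L[ℝ] ℝ} {p'' : V →L[ℝ] V →L[ℝ] ℝ} {x : V}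
    {h h₁ : ℝ → ℂ} {h₂ : ℂ}
    (hp : ∀ y, HasFDerivAt p (p' y) y) (hp' : HasFDerivAt p' p'' x)
    (hh : ∀ᶠ t in 𝓝 (p x), HasDerivAt h (h₁ t) t) (hh₁ : HasDerivAt h₁ h₂ (p x)) :
    Δ (fun y => h (p y)) x =
      h₂ * ((∑ i, (p' x (v i)) ^ 2 : ℝ) : ℂ) + h₁ (p x) * ((∑ i, p'' (v i) (v i) : ℝ) : ℂ) := by
  have hfirst : ∀ᶠ y in 𝓝 x,
      fderiv ℝ (fun y => h (p y)) y = (p' y).smulRight (h₁ (p y)) := by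
    filter_upwards [(hp x).continuousAt.eventually hh] with y hy
    refine HasFDerivAt.fderiv ?_
    refine (hy.hasFDerivAt.comp y (hp y)).congr_fderiv ?_
    ext a
    simp
  have hsecond : HasFDerivAt (fun y => (p' y).smulRight (h₁ (p y)))
      (((ContinuousLinearMap.smulRightL ℝ V ℂ).flip (h₁ (p x))).comp p'' +
        ((ContinuousLinearMap.smulRightL ℝ V ℂ) (p' x)).comp ((p' x).smulRight h₂)) x := by
    have h1 : HasFDerivAt (fun y => h₁ (p y)) ((p' x).smulRight h₂) x := by
      refine (hh₁.hasFDerivAt.comp x (hp x)).congr_fderiv ?_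
      ext a
      simp
    have := (ContinuousLinearMap.smulRightL ℝ V ℂ).hasFDerivAt_of_bilinear hp' h1
    refine this.congr_fderiv ?_
    ext a b
    simp [ContinuousLinearMap.precompL, ContinuousLinearMap.precompR]
    ring
  rw [InnerProductSpace.laplacian_eq_iteratedFDeriv_orthonormalBasis _ v]
  simp only [iteratedFDeriv_two_apply]
  rw [Filter.EventuallyEq.fderiv_eq hfirst, hsecond.fderiv]
  simp [Finset.mul_sum, ← Finset.sum_add_distrib]
  refine Finset.sum_congr rfl fun i _ => ?_
  ring

theorem contDiff_planeWave (k : ℝ) (ν : R3) :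
    ContDiff ℝ ∞ (fun x : R3 => Complex.exp (Complex.I * (k * inner ℝ ν x : ℝ))) := by
  have : ContDiff ℝ ∞ (fun x : R3 => ((k * inner ℝ ν x : ℝ) : ℂ)) :=
    Complex.ofRealCLM.contDiff.comp (contDiff_const.mul (contDiff_const.inner ℝ contDiff_id))
  exact (contDiff_const.mul this).cexp

theorem laplacian_planeWave (k : ℝ) {ν : R3} (hν : ‖ν‖ = 1) (x : R3) :
    Δ (fun x : R3 => Complex.exp (Complex.I * (k * inner ℝ ν x : ℝ))) x =
      -(k : ℂ) ^ 2 * Complex.exp (Complex.I * (k * inner ℝ ν x : ℝ)) := by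
  have hd : ∀ (c : ℂ) (t : ℝ), HasDerivAt
      (fun t : ℝ => c * Complex.exp (Complex.I * (k * t : ℝ)))
      (c * (Complex.I * k) * Complex.exp (Complex.I * (k * t : ℝ))) t := by
    intro c t
    have h1 : HasDerivAt (fun t : ℝ => Complex.I * ((k * t : ℝ) : ℂ)) (Complex.I * k) t := by
      have := ((hasDerivAt_id t).const_mul k).ofReal_comp.const_mul Complex.I
      simpa using this
    refine (h1.cexp.const_mul c).congr_deriv ?_
    ring
  have := laplacian_comp_eq_sum (EuclideanSpace.basisFun (Fin 3) ℝ) (p := fun y => inner ℝ ν y)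
    (p' := fun _ => innerSL ℝ ν) (p'' := 0) (x := x)
    (h := fun t : ℝ => 1 * Complex.exp (Complex.I * (k * t : ℝ)))
    (h₁ := fun t : ℝ => 1 * (Complex.I * k) * Complex.exp (Complex.I * (k * t : ℝ)))
    (fun y => (innerSL ℝ ν).hasFDerivAt) (hasFDerivAt_const _ _)
    (Eventually.of_forall fun t => hd 1 t) (hd _ _)
  simp only [one_mul] at this
  rw [this]
  have hs : ∑ i, (innerSL ℝ ν (EuclideanSpace.basisFun (Fin 3) ℝ i)) ^ 2 = 1 := by
    have := (EuclideanSpace.basisFun (Fin 3) ℝ).sum_sq_norm_inner_left ν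
    simpa [hν] using this
  rw [hs]
  simp
  linear_combination (k : ℂ) ^ 2 * Complex.exp (Complex.I * (k * inner ℝ ν x)) * Complex.I_sq

/-- The outgoing spherical wave `exp(ik|x|) / (4π|x|)`. -/
noncomputable def sphericalWave (k : ℝ) (x : R3) : ℂ :=
  Complex.exp (Complex.I * (k * ‖x‖ : ℝ)) / (4 * Real.pi * ‖x‖ : ℝ)

theorem contDiffAt_sphericalWave (k : ℝ) {x : R3} (hx : x ≠ 0) :
    ContDiffAt ℝ ∞ (sphericalWave k) x := by
  have hn : ContDiffAt ℝ ∞ (fun x : R3 => ‖x‖) x := contDiffAt_norm ℝ hx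
  have h1 : ContDiffAt ℝ ∞ (fun x : R3 => ((k * ‖x‖ : ℝ) : ℂ)) x :=
    Complex.ofRealCLM.contDiff.contDiffAt.comp x (contDiffAt_const.mul hn)
  have h2 : ContDiffAt ℝ ∞ (fun x : R3 => ((4 * Real.pi * ‖x‖ : ℝ) : ℂ)) x :=
    Complex.ofRealCLM.contDiff.contDiffAt.comp x (contDiffAt_const.mul hn)
  unfold sphericalWave
  simp_rw [div_eq_mul_inv]
  refine (contDiffAt_const.mul h1).cexp.mul (h2.inv ?_)
  have := norm_pos_iff.mpr hx
  have := Real.pi_pos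
  exact_mod_cast (by positivity : 4 * Real.pi * ‖x‖ ≠ 0)

theorem laplacian_sphericalWave (k : ℝ) {x : R3} (hx : x ≠ 0) :
    Δ (sphericalWave k) x = -(k : ℂ) ^ 2 * sphericalWave k x := by
  have hpos : 0 < ‖x‖ ^ 2 := by have := norm_pos_iff.mpr hx; positivity
  -- In the variable `s = |x|²` the wave is a smooth function on `s > 0`.
  let E : ℝ → ℂ := fun s => Complex.exp (Complex.I * (k * √s : ℝ))
  have hsq : ∀ s : ℝ, 0 < s → HasDerivAt (fun s : ℝ => ((√s : ℝ) : ℂ)) (1 / (2 * (√s : ℝ))) s := by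
    intro s hs
    simpa using (Real.hasDerivAt_sqrt hs.ne').ofReal_comp
  have hE : ∀ s : ℝ, 0 < s → HasDerivAt E (E s * (Complex.I * k * (1 / (2 * (√s : ℝ))))) s := by
    intro s hs
    have : HasDerivAt (fun s : ℝ => Complex.I * ((k * √s : ℝ) : ℂ))
        (Complex.I * k * (1 / (2 * (√s : ℝ)))) s := by
      have := (hsq s hs).const_mul (Complex.I * k)
      simpa [mul_assoc] using this
    exact this.cexp
  have hpi : (Real.pi : ℂ) ≠ 0 := by exact_mod_cast Real.pi_ne_zero
  have hr0 : ∀ s : ℝ, 0 < s → ((√s : ℝ) : ℂ) ≠ 0 := by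
    intro s hs; exact_mod_cast (Real.sqrt_pos.mpr hs).ne'
  let h : ℝ → ℂ := fun s => E s / (4 * Real.pi * √s : ℝ)
  let h₁ : ℝ → ℂ := fun s =>
    E s * (Complex.I * k * (√s : ℝ) - 1) / (8 * Real.pi * (√s : ℝ) ^ 3)
  let h₂ : ℝ → ℂ := fun s =>
    E s * ((Complex.I * k * (√s : ℝ)) ^ 2 - 3 * (Complex.I * k * (√s : ℝ)) + 3) /
      (16 * Real.pi * (√s : ℝ) ^ 5)
  have hh : ∀ s : ℝ, 0 < s → HasDerivAt h (h₁ s) s := by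
    intro s hs
    have hne := hr0 s hs
    have := (hE s hs).div ((hsq s hs).const_mul (4 * Real.pi : ℂ))
      (mul_ne_zero (mul_ne_zero (by norm_num) hpi) hne)
    refine (this.congr_deriv ?_).congr_of_eventuallyEq (Eventually.of_forall fun t => ?_)
    · simp only [h₁]; field_simp; ring
    · simp [h]
  have hh₁ : ∀ s : ℝ, 0 < s → HasDerivAt h₁ (h₂ s) s := by
    intro s hs
    have hne := hr0 s hs
    have := ((hE s hs).mul (((hsq s hs).const_mul (Complex.I * k)).sub_const 1)).div
      (((hsq s hs).pow 3).const_mul (8 * Real.pi : ℂ))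
      (mul_ne_zero (mul_ne_zero (by norm_num) hpi) (pow_ne_zero 3 hne))
    refine this.congr_deriv ?_
    simp only [h₂, Pi.mul_apply, Pi.pow_apply]; field_simp; ring
  have key := laplacian_comp_eq_sum (EuclideanSpace.basisFun (Fin 3) ℝ)
    (p := fun y : R3 => ‖y‖ ^ 2)
    (p' := fun y => 2 • innerSL ℝ y) (p'' := 2 • innerSL ℝ) (x := x)
    (h := h) (h₁ := h₁) (h₂ := h₂ (‖x‖ ^ 2))
    (fun y => (hasStrictFDerivAt_norm_sq y).hasFDerivAt)
    (((innerSL ℝ : R3 →L[ℝ] R3 →L[ℝ] ℝ).hasFDerivAt).const_smul 2)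
    ((lt_mem_nhds hpos).mono fun s hs => hh s hs) (hh₁ _ hpos)
  have hfun : sphericalWave k = fun y : R3 => h (‖y‖ ^ 2) := by
    ext y
    simp [sphericalWave, h, E]
  rw [hfun, key]
  have hs1 : ∑ i, ((2 • innerSL ℝ x) (EuclideanSpace.basisFun (Fin 3) ℝ i)) ^ 2 = 4 * ‖x‖ ^ 2 := by
    have := (EuclideanSpace.basisFun (Fin 3) ℝ).sum_sq_norm_inner_left x
    rw [← this, Finset.mul_sum]
    refine Finset.sum_congr rfl fun i _ => ?_
    simp
    ring
  have hs2 : ∑ i, ((2 • innerSL ℝ : R3 →L[ℝ] R3 →L[ℝ] ℝ)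
      (EuclideanSpace.basisFun (Fin 3) ℝ i)) (EuclideanSpace.basisFun (Fin 3) ℝ i) = 6 := by
    have : ∀ i : Fin 3, innerSL ℝ (EuclideanSpace.single i (1 : ℝ)) (EuclideanSpace.single i 1) =
        (1 : ℝ) := fun i => by simp [innerSL_apply_apply]
    simp [this]
    norm_num
  rw [hs1, hs2]
  have hxn : (‖x‖ : ℂ) ≠ 0 := by exact_mod_cast norm_ne_zero_iff.mpr hx
  simp only [h, h₁, h₂, Real.sqrt_sq (norm_nonneg x)]
  push_cast
  field_simp
  ring_nf
  simp [Complex.I_sq]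

/-! ### Cut-off solutions of the Helmholtz equation in the domain of the outer adjoint -/

theorem ContDiffAt.continuousAt_laplacian {V F : Type*} [NormedAddCommGroup V]
    [InnerProductSpace ℝ V] [FiniteDimensional ℝ V] [NormedAddCommGroup F] [NormedSpace ℝ F]
    {u : V → F} {x : V} (hu : ContDiffAt ℝ 2 u x) : ContinuousAt (Δ u) x := by
  rw [InnerProductSpace.laplacian_eq_iteratedFDeriv_stdOrthonormalBasis]
  have h : ContinuousAt (iteratedFDeriv ℝ 2 u) x :=
    (hu.iteratedFDeriv_right (m := 0) (i := 2) (by norm_num)).continuousAt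
  exact tendsto_finsetSum _ fun i _ =>
    (ContinuousMultilinearMap.apply ℝ (fun _ : Fin 2 => V) F _).continuous.continuousAt.comp h

theorem laplacian_eq_zero_of_notMem_tsupport {V F : Type*} [NormedAddCommGroup V]
    [InnerProductSpace ℝ V] [FiniteDimensional ℝ V] [NormedAddCommGroup F] [NormedSpace ℝ F]
    {u : V → F} {x : V} (hx : x ∉ tsupport u) : Δ u x = 0 := by
  have h := notMem_tsupport_iff_eventuallyEq.mp hx
  rw [(InnerProductSpace.laplacian_congr_nhds h).eq_of_nhds]
  exact congrFun (InnerProductSpace.laplacian_const (c := (0 : F))) x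

/-- Green's identity for a function that is smooth away from the origin, tested against functions
that vanish near the origin: the singular part of `u` is removed by a cut-off which the test
function does not feel. -/
theorem IsOuterTest.integral_conj_laplacian_mul {φ u : R3 → ℂ} (hφ : IsOuterTest φ)
    (hu : ∀ x ≠ 0, ContDiffAt ℝ ∞ u x) (hcs : HasCompactSupport u) :
    ∫ x, conj (-(Δ φ x)) * u x = ∫ x, conj (φ x) * -(Δ u x) := by
  obtain ⟨hφs, hφc, hφ0⟩ := hφ
  obtain ⟨r, hr, hball⟩ := Metric.nhds_basis_closedBall.mem_iff.mp
    ((isClosed_tsupport φ).isOpen_compl.mem_nhds hφ0)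
  let β : ContDiffBump (0 : R3) := ⟨r / 2, r, half_pos hr, half_lt_self hr⟩
  let v : R3 → ℂ := fun x => ((1 - β x : ℝ) : ℂ) * u x
  have hv : ContDiff ℝ ∞ v := by
    rw [contDiff_iff_contDiffAt]
    intro x
    by_cases hx : x = 0
    · subst hx
      refine (contDiffAt_const (c := (0 : ℂ))).congr_of_eventuallyEq ?_
      filter_upwards [β.eventuallyEq_one] with y hy
      simp [v, hy]
    · refine ContDiffAt.mul ?_ (hu x hx)
      exact Complex.ofRealCLM.contDiff.contDiffAt.comp x
        (contDiffAt_const.sub β.contDiffAt)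
  have hvc : HasCompactSupport v := hcs.mul_left
  have hvu : ∀ x ∈ tsupport φ, v =ᶠ[𝓝 x] u := by
    intro x hx
    have hx' : x ∉ tsupport β := by
      rw [β.tsupport_eq]
      exact fun h => hball h hx
    filter_upwards [notMem_tsupport_iff_eventuallyEq.mp hx'] with y hy
    simp [v, hy]
  let ψ : R3 → ℂ := fun x => conj (φ x)
  have hψ : ContDiff ℝ ∞ ψ := Complex.conjCLE.contDiff.comp hφs
  have hψc : HasCompactSupport ψ := hφc.comp_left (g := conj) (map_zero _)
  have hΔψ : ∀ x, Δ ψ x = conj (Δ φ x) := fun x =>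
    congrFun (InnerProductSpace.laplacian_CLE_comp_left (f := φ) (l := Complex.conjCLE)) x
  have green : ∫ x, ψ x * Δ v x = ∫ x, Δ ψ x * v x := by
    have := SchwartzMap.integral_mul_laplacian_right_eq_left (μ := (volume : Measure R3))
      (hψc.toSchwartzMap hψ) (hvc.toSchwartzMap hv)
    simp only [SchwartzMap.laplacian_apply] at this
    exact this
  have hl : ∀ x, conj (-(Δ φ x)) * u x = -(Δ ψ x * v x) := by
    intro x
    by_cases hx : x ∈ tsupport φ
    · rw [hΔψ, (hvu x hx).eq_of_nhds]
      simp
    · simp [hΔψ, laplacian_eq_zero_of_notMem_tsupport hx]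
  have hright : ∀ x, conj (φ x) * -(Δ u x) = -(ψ x * Δ v x) := by
    intro x
    by_cases hx : x ∈ tsupport φ
    · rw [(InnerProductSpace.laplacian_congr_nhds (hvu x hx)).eq_of_nhds]
      simp [ψ]
    · simp [ψ, image_eq_zero_of_notMem_tsupport hx]
  simp only [hl, hright, integral_neg, green]

/-- A cut-off solution `w` of the Helmholtz equation on `ℝ³ ∖ {0}` is sent by the outer adjoint to
`-Δ(χ w)`, which is `lam • w` where the cut-off is not felt. -/
theorem exists_outerAdjoint_cutoff {χ : R3 → ℝ} (hχ : ContDiff ℝ ∞ χ)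
    (hχc : HasCompactSupport χ) (hχ1 : ∀ᶠ x in 𝓝 0, χ x = 1) {w : R3 → ℂ} {lam : ℂ}
    (hw : ∀ x ≠ 0, ContDiffAt ℝ ∞ w x) (hΔ : ∀ x ≠ 0, Δ w x = -lam * w x)
    (hL2 : MemLp (fun x => (χ x : ℂ) * w x) 2 (volume : Measure R3)) :
    ∃ f : R3 → ℂ, OuterAdjoint (fun x => (χ x : ℂ) * w x) f ∧
      ∀ᵐ x : R3, (∀ᶠ x' in 𝓝 x, χ x' = 1) → f x = lam * w x := by
  set u : R3 → ℂ := fun x => (χ x : ℂ) * w x with hu_def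
  have hχ' : HasCompactSupport (fun x => (χ x : ℂ)) :=
    hχc.comp_left (g := fun t : ℝ => (t : ℂ)) Complex.ofReal_zero
  have hcs : HasCompactSupport u := hχ'.mul_right
  have hu : ∀ x ≠ 0, ContDiffAt ℝ ∞ u x := fun x hx =>
    ContDiffAt.mul (Complex.ofRealCLM.contDiff.contDiffAt.comp x hχ.contDiffAt) (hw x hx)
  have hloc : ∀ x ≠ 0, (∀ᶠ x' in 𝓝 x, χ x' = 1) → -(Δ u x) = lam * w x := by
    intro x hx h1
    have : u =ᶠ[𝓝 x] w := by
      filter_upwards [h1] with y hy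
      simp [u, hy]
    rw [(InnerProductSpace.laplacian_congr_nhds this).eq_of_nhds, hΔ x hx]
    ring
  have hae : ∀ᵐ x : R3, x ≠ 0 := by simp [ae_iff]
  refine ⟨fun x => -(Δ u x), ⟨hL2, ?_, fun φ hφ => hφ.integral_conj_laplacian_mul hu hcs⟩, ?_⟩
  -- Given the value `0` at the origin, `-Δu - lam u` is continuous with compact support.
  · let h : R3 → ℂ := fun x => if x = 0 then 0 else -(Δ u x) - lam * u x
    have hcont : Continuous h := by
      rw [continuous_iff_continuousAt]
      intro x
      by_cases hx : x = 0
      · subst hx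
        refine (continuousAt_const (y := (0 : ℂ))).congr ?_
        filter_upwards [hχ1.eventually_nhds] with y hy
        by_cases hy0 : y = 0
        · simp [h, hy0]
        · simp [h, hy0, hloc y hy0 hy, u, hy.self_of_nhds]
      · have hc : ContinuousAt (fun x => -(Δ u x) - lam * u x) x :=
          (((hu x hx).of_le (WithTop.coe_le_coe.mpr le_top)).continuousAt_laplacian.neg).sub
            (continuousAt_const.mul (hu x hx).continuousAt)
        refine hc.congr ?_
        filter_upwards [isOpen_ne.mem_nhds hx] with y hy
        simp [h, show y ≠ 0 from hy]
    have hhc : HasCompactSupport h := by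
      refine HasCompactSupport.intro hcs fun x hx => ?_
      simp [h, laplacian_eq_zero_of_notMem_tsupport hx, image_eq_zero_of_notMem_tsupport hx]
    have hmem : MemLp h 2 (volume : Measure R3) := hcont.memLp_of_hasCompactSupport hhc
    refine (memLp_congr_ae ?_).mp (hmem.add (hL2.const_mul lam))
    filter_upwards [hae] with x hx
    simp [h, hx, u]
  · filter_upwards [hae] with x hx h1 using hloc x hx h1

theorem norm_sphericalWave (k : ℝ) (x : R3) :
    ‖sphericalWave k x‖ = (4 * Real.pi)⁻¹ * ‖x‖⁻¹ := by
  rw [sphericalWave, norm_div, mul_comm Complex.I, Complex.norm_exp_ofReal_mul_I,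
    Complex.norm_real, Real.norm_of_nonneg (by positivity)]
  rw [one_div, mul_inv]

theorem measurable_sphericalWave (k : ℝ) : Measurable (sphericalWave k) := by
  unfold sphericalWave
  fun_prop

/-- `|x|⁻²` is locally integrable in dimension three. -/
theorem memLp_cutoff_sphericalWave {χ : R3 → ℝ} (hχ : Continuous χ)
    (hχc : HasCompactSupport χ) (k : ℝ) :
    MemLp (fun x => (χ x : ℂ) * sphericalWave k x) 2 (volume : Measure R3) := by
  have hm := (measurable_sphericalWave k).aestronglyMeasurable (μ := (volume : Measure R3))
  rw [memLp_two_iff_integrable_sq_norm (by fun_prop)]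
  have hloc : LocallyIntegrable (fun x : R3 => ‖sphericalWave k x‖ ^ 2) volume := by
    refine locallyIntegrable_of_norm_le_rpow (C := ((4 * Real.pi)⁻¹) ^ 2) (α := 2) (by simp)
      (by simp; norm_num) (Eventually.of_forall fun x => le_of_eq ?_) (by fun_prop)
    rw [norm_sphericalWave, Real.rpow_neg (norm_nonneg x), Real.rpow_two,
      Real.norm_of_nonneg (by positivity)]
    ring
  have := hloc.integrable_smul_left_of_hasCompactSupport (g := fun x => χ x ^ 2) (by fun_prop)
    (hχc.comp_left (g := fun t : ℝ => t ^ 2) (by simp))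
  refine this.congr (Eventually.of_forall fun x => ?_)
  simp [mul_pow]

theorem outerWave_eq (lam : ℝ) (ν : R3) (T : ℂ) (x : R3) :
    outerWave lam ν T x = Complex.exp (Complex.I * (Real.sqrt lam * inner ℝ ν x : ℝ)) +
      T * sphericalWave (Real.sqrt lam) x := rfl

theorem exists_outerAdjoint_outerWave {lam : ℝ} (hlam : 0 < lam) {ν : R3} (hν : ‖ν‖ = 1) (T : ℂ)
    {χ : R3 → ℝ} (hχ : ContDiff ℝ ∞ χ) (hχc : HasCompactSupport χ)
    (hχ1 : ∀ᶠ x in 𝓝 0, χ x = 1) :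
    ∃ f : R3 → ℂ, OuterAdjoint (fun x => (χ x : ℂ) * outerWave lam ν T x) f ∧
      ∀ᵐ x : R3, (∀ᶠ x' in 𝓝 x, χ x' = 1) → f x = lam * outerWave lam ν T x := by
  set k := Real.sqrt lam
  let p : R3 → ℂ := fun x => Complex.exp (Complex.I * (k * inner ℝ ν x : ℝ))
  have hp : ContDiff ℝ ∞ p := contDiff_planeWave k ν
  have hs : ∀ x ≠ 0, ContDiffAt ℝ ∞ (T • sphericalWave k) x := fun x hx =>
    contDiffAt_const.smul (contDiffAt_sphericalWave k hx)
  have hw : outerWave lam ν T = p + T • sphericalWave k := rfl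
  have hk : (k : ℂ) ^ 2 = lam := by exact_mod_cast Real.sq_sqrt hlam.le
  have h2 : (2 : WithTop ℕ∞) ≤ ∞ := WithTop.coe_le_coe.mpr le_top
  refine exists_outerAdjoint_cutoff hχ hχc hχ1 (fun x hx => ?_) (fun x hx => ?_) ?_
  · rw [hw]
    exact hp.contDiffAt.add (hs x hx)
  · rw [hw, (hp.contDiffAt.of_le h2).laplacian_add ((hs x hx).of_le h2),
      InnerProductSpace.laplacian_smul T ((contDiffAt_sphericalWave k hx).of_le h2),
      laplacian_planeWave k hν, laplacian_sphericalWave k hx, hk]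
    simp only [Pi.add_apply, Pi.smul_apply, smul_eq_mul, p]
    ring
  · have h1 : MemLp (fun x => (χ x : ℂ) * p x) 2 (volume : Measure R3) := by
      have hc := hχ.continuous
      have hpc := hp.continuous
      refine Continuous.memLp_of_hasCompactSupport (by fun_prop) ?_
      exact (hχc.comp_left (g := fun t : ℝ => (t : ℂ)) Complex.ofReal_zero).mul_right
    refine (memLp_congr_ae (Eventually.of_forall fun x => ?_)).mp
      (h1.add ((memLp_cutoff_sphericalWave hχ.continuous hχc k).const_mul T))
    simp only [Pi.add_apply, outerWave_eq, p, k]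
    ring

/-! ### Asymptotic boundary values at the origin -/

theorem nhds_zero_inf_ae_le : 𝓝 (0 : R3) ⊓ ae volume ≤ 𝓝[≠] 0 :=
  inf_le_inf_left _ (le_principal_iff.mpr (by simp [mem_ae_iff]))

instance nhds_zero_inf_ae_neBot : NeBot (𝓝 (0 : R3) ⊓ ae volume) := by
  rw [inf_neBot_iff]
  intro s hs t ht
  by_contra hne
  rw [Set.not_nonempty_iff_eq_empty, ← Set.disjoint_iff_inter_eq_empty] at hne
  have h0 : volume s = 0 := measure_mono_null hne.subset_compl_right (mem_ae_iff.mp ht)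
  exact (Measure.measure_pos_of_mem_nhds volume hs).ne' h0

/-- Boundary values are unique: a set of full measure accumulates at the origin, where
`1 / (4π|x|)` is unbounded. -/
theorem HasOuterBoundaryValues.unique {u : R3 → ℂ} {A A' b b' : ℂ}
    (h : HasOuterBoundaryValues u A b) (h' : HasOuterBoundaryValues u A' b') :
    A = A' ∧ b = b' := by
  have hnorm : Tendsto (fun x : R3 => ((4 * Real.pi * ‖x‖ : ℝ) : ℂ)) (𝓝 0 ⊓ ae volume) (𝓝 0) := by
    have : Continuous (fun x : R3 => ((4 * Real.pi * ‖x‖ : ℝ) : ℂ)) := by fun_prop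
    have h0 := this.tendsto 0
    simp only [norm_zero, mul_zero, Complex.ofReal_zero] at h0
    exact h0.mono_left inf_le_left
  have hA : A = A' := by
    have h0 : Tendsto (fun _ : R3 => A' - A) (𝓝 0 ⊓ ae volume) (𝓝 0) := by
      have := hnorm.mul (Tendsto.sub h h')
      rw [zero_mul] at this
      refine this.congr' ?_
      filter_upwards [nhds_zero_inf_ae_le self_mem_nhdsWithin] with x hx
      have hx' : ((4 * Real.pi * ‖x‖ : ℝ) : ℂ) ≠ 0 := by
        have := norm_pos_iff.mpr (show x ≠ 0 from hx)
        have := Real.pi_pos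
        exact_mod_cast (by positivity : 4 * Real.pi * ‖x‖ ≠ 0)
      field_simp
      ring
    exact (sub_eq_zero.mp (tendsto_nhds_unique tendsto_const_nhds h0)).symm
  subst hA
  exact ⟨rfl, tendsto_nhds_unique h h'⟩

theorem HasOuterBoundaryValues.congr {u w : R3 → ℂ} {A b : ℂ} (h : HasOuterBoundaryValues u A b)
    (huw : u =ᶠ[𝓝 0] w) : HasOuterBoundaryValues w A b := by
  refine Tendsto.congr' ?_ h
  filter_upwards [huw.filter_mono inf_le_left] with x hx
  rw [hx]

/-- The plane wave contributes `1` to the regular part, and the spherical wave `T` times the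
derivative of `exp(ikr) / (4π)` at `r = 0`. -/
theorem hasOuterBoundaryValues_outerWave (lam : ℝ) (ν : R3) (T : ℂ) :
    HasOuterBoundaryValues (outerWave lam ν T) T
      (1 + T * (Complex.I * (Real.sqrt lam / (4 * Real.pi) : ℝ))) := by
  set k := Real.sqrt lam
  have hplane : Tendsto (fun x : R3 => Complex.exp (Complex.I * (k * inner ℝ ν x : ℝ)))
      (𝓝 0 ⊓ ae volume) (𝓝 1) := by
    have := (contDiff_planeWave k ν).continuous.tendsto 0
    simp only [inner_zero_right, mul_zero, Complex.ofReal_zero, Complex.exp_zero] at this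
    exact this.mono_left inf_le_left
  have hd : HasDerivAt (fun t : ℝ => Complex.exp (Complex.I * (k * t : ℝ))) (Complex.I * k) 0 := by
    have h1 : HasDerivAt (fun t : ℝ => Complex.I * ((k * t : ℝ) : ℂ)) (Complex.I * k) 0 := by
      simpa using ((hasDerivAt_id (0 : ℝ)).const_mul k).ofReal_comp.const_mul Complex.I
    simpa using h1.cexp
  have hslope := hasDerivAt_iff_tendsto_slope_zero.mp hd
  have hsph : Tendsto (fun x : R3 => sphericalWave k x - 1 / (4 * Real.pi * ‖x‖ : ℝ))
      (𝓝 0 ⊓ ae volume) (𝓝 (Complex.I * (k / (4 * Real.pi) : ℝ))) := by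
    have hn : Tendsto (fun x : R3 => ‖x‖) (𝓝 0 ⊓ ae volume) (𝓝[≠] 0) :=
      (tendsto_norm_nhdsNE_zero.mono_left nhds_zero_inf_ae_le).mono_right
        (nhdsWithin_mono _ fun t ht => (ne_of_gt ht))
    have := (hslope.comp hn).const_mul ((4 * Real.pi : ℝ) : ℂ)⁻¹
    have hlim : ((4 * Real.pi : ℝ) : ℂ)⁻¹ * (Complex.I * k) =
        Complex.I * (k / (4 * Real.pi) : ℝ) := by
      push_cast
      ring
    rw [hlim] at this
    refine this.congr fun x => ?_
    simp only [Function.comp_apply, zero_add, mul_zero, Complex.ofReal_zero, Complex.exp_zero,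
      sphericalWave, Complex.real_smul]
    push_cast
    ring
  refine (hplane.add (hsph.const_mul T)).congr fun x => ?_
  rw [outerWave_eq]
  ring

/-! ### The indefinite product -/

namespace InnerModel

variable {E : Type*} [NormedAddCommGroup E] [InnerProductSpace ℂ E] [FiniteDimensional ℂ E]
variable (M : InnerModel E)

theorem metricOp_isSymmetric (K : Submodule ℂ E) : (metricOp K).IsSymmetric := by
  intro x y
  simp [metricOp, inner_sub_left, inner_sub_right, Submodule.inner_starProjection_left_eq_right]

theorem ip_conj (x y : E) : conj (M.ip x y) = M.ip y x := by
  simp only [ip, gProd]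
  rw [inner_conj_symm, ← metricOp_isSymmetric]

theorem ip_sub_right (x y z : E) : M.ip x (y - z) = M.ip x y - M.ip x z := inner_sub_right _ _ _

theorem ip_smul_right (c : ℂ) (x y : E) : M.ip x (c • y) = c * M.ip x y := inner_smul_right _ _ _

theorem ip_B (x y : E) : M.ip (M.B x) y = M.ip x (M.B y) := by
  simp only [ip, gProd]
  have h : metricOp M.Eplus (M.B x) = M.B (metricOp M.Eplus x) :=
    (LinearMap.congr_fun M.comm.eq x).symm
  rw [h, M.symm]

theorem ip_sub_smul_left (z : ℂ) (x y : E) :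
    M.ip (M.B x - z • x) y = M.ip x (M.B y - conj z • y) := by
  rw [← M.ip_conj, ip_sub_right, ip_smul_right, map_sub, map_mul, ip_conj, ip_conj, ip_B,
    ip_sub_right, ip_smul_right]

theorem ip_e_e : M.ip M.e M.e = 1 := M.e_norm

/-! ### The resolvent -/

theorem sub_invSub {z : ℂ} (hz : ∀ x, M.B x = z • x → x = 0) (v : E) :
    M.B (M.invSub z v) - z • M.invSub z v = v := by
  have hu : IsUnit (M.B - z • (1 : Module.End ℂ E)) := by
    rw [LinearMap.isUnit_iff_ker_eq_bot, LinearMap.ker_eq_bot']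
    intro x hx
    exact hz x (sub_eq_zero.mp (by simpa using hx))
  have := LinearMap.congr_fun (Ring.mul_inverse_cancel _ hu) v
  simpa [invSub] using this

theorem eq_zero_of_eq_smul {z : ℂ} (hz : z.im ≠ 0) (x : E) (hx : M.B x = z • x) : x = 0 := by
  have h := M.symm x x
  rw [hx, inner_smul_left, inner_smul_right, ← sub_eq_zero, ← sub_mul] at h
  rcases mul_eq_zero.mp h with h | h
  · exact absurd (Complex.conj_eq_iff_im.mp (sub_eq_zero.mp h)) hz
  · exact inner_self_eq_zero.mp h

theorem sub_invSub_I (v : E) : M.B (M.invSub Complex.I v) - Complex.I • M.invSub Complex.I v = v :=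
  M.sub_invSub (M.eq_zero_of_eq_smul (by simp)) v

theorem mem_restrictedDomain_iff {x : E} :
    x ∈ M.restrictedDomain ↔ M.ip (M.B x - Complex.I • x) M.e = 0 := by
  constructor
  · rintro ⟨v, hv, rfl⟩
    rwa [sub_invSub_I]
  · intro h
    refine ⟨_, h, ?_⟩
    have h1 := M.sub_invSub_I (M.B x - Complex.I • x)
    have h2 := M.eq_zero_of_eq_smul (z := Complex.I) (by simp)
      (x - M.invSub Complex.I (M.B x - Complex.I • x)) (by
        rw [map_sub, smul_sub, ← sub_eq_zero]
        linear_combination (norm := module) -h1)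
    exact sub_eq_zero.mp h2

/-! ### Symplectic coordinates in the inner channel -/

theorem wPlus_eq : M.wPlus = M.B (M.invSub Complex.I M.e) := by
  have h := M.sub_invSub_I M.e
  rw [wPlus, e']
  simp only [LinearMap.add_apply, LinearMap.smul_apply, Module.End.one_apply]
  nth_rewrite 1 [← h]
  module

theorem wMinus_eq : M.wMinus = -M.invSub Complex.I M.e := by
  have h := M.sub_invSub_I M.e
  rw [wMinus, e']
  simp only [LinearMap.add_apply, LinearMap.smul_apply, Module.End.one_apply]
  nth_rewrite 1 [← h]
  rw [show M.B (M.invSub Complex.I M.e) - Complex.I • M.invSub Complex.I M.e -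
      (M.B (M.invSub Complex.I M.e) + Complex.I • M.invSub Complex.I M.e) =
      (-(2 * Complex.I)) • M.invSub Complex.I M.e by module, smul_smul]
  rw [show (1 / (2 * Complex.I)) * (-(2 * Complex.I)) = -1 by
    field_simp [Complex.I_ne_zero]]
  simp

/-- The symplectic coordinates without reference to `x₀`. With `u = (B - i)⁻¹ e` one has `w₊ = B u`
and `w₋ = -u`, so eliminating `x₀` from the two equations leaves `B y - z = ξ₊ (B² + 1) u`, that is
the first condition; the second one is `[(B - i) x₀, e] = 0`, the membership of `x₀` in the
restricted domain. -/
theorem hasInnerCoords_iff {y z : E} {ξp ξm : ℂ} :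
    M.HasInnerCoords y z ξp ξm ↔
      M.B y - z = ξp • (M.B M.e + Complex.I • M.e) ∧
      ξm = -M.ip M.e (M.B y - Complex.I • y - ξp • M.B M.e) := by
  have he := M.sub_invSub_I M.e
  have hp := M.wPlus_eq
  have hm := M.wMinus_eq
  generalize M.invSub Complex.I M.e = u at he hp hm
  have hBe' : M.B M.e = M.B (M.B u) - Complex.I • M.B u := by
    rw [← he, map_sub, map_smul]
  have hBe : M.B M.e + Complex.I • M.e = M.B (M.B u) + u := by
    rw [hBe', ← he, smul_sub, smul_smul, Complex.I_mul_I]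
    module
  have hx0 : ∀ x₀ : E, y = x₀ + ξp • M.wPlus + ξm • M.wMinus →
      (x₀ ∈ M.restrictedDomain ↔
        ξm = -M.ip M.e (M.B y - Complex.I • y - ξp • M.B M.e)) := by
    rintro x₀ hy
    have h1 : M.B y - Complex.I • y - ξp • M.B M.e =
        (M.B x₀ - Complex.I • x₀) - ξm • M.e := by
      rw [hy, hp, hm, hBe', ← he]
      simp only [map_add, map_smul, map_neg]
      module
    rw [h1, ip_sub_right, ip_smul_right, ip_e_e, mem_restrictedDomain_iff, ← M.ip_conj,
      map_eq_zero]
    constructor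
    · intro h; rw [h]; ring
    · intro h; linear_combination h
  constructor
  · rintro ⟨x₀, hx, hy, hz⟩
    refine ⟨?_, (hx0 x₀ hy).mp hx⟩
    rw [hy, hz, hBe, hp, hm]
    simp only [map_add, map_smul, map_neg]
    module
  · rintro ⟨h1, h2⟩
    have hy : y = (y - ξp • M.wPlus - ξm • M.wMinus) + ξp • M.wPlus + ξm • M.wMinus := by module
    refine ⟨_, (hx0 _ hy).mpr h2, hy, ?_⟩
    have hz : z = M.B y - ξp • (M.B (M.B u) + u) := by
      rw [← hBe, ← h1]
      module
    rw [hz, hp, hm]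
    simp only [map_sub, map_smul, map_neg]
    module

/-- `(B + i) e ≠ 0`, which makes the coordinate `ξ₊` unique. -/
theorem eq_of_smul_add_I_smul_e {c d : ℂ}
    (h : c • (M.B M.e + Complex.I • M.e) = d • (M.B M.e + Complex.I • M.e)) : c = d := by
  by_contra hne
  rw [← sub_eq_zero, ← sub_smul, smul_eq_zero] at h
  have h0 : M.B M.e = (-Complex.I) • M.e := by
    rcases h with h | h
    · exact absurd (sub_eq_zero.mp h) hne
    · rw [neg_smul]
      exact eq_neg_of_add_eq_zero_left h
  have he : M.e = 0 := M.eq_zero_of_eq_smul (by simp) _ h0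
  have := M.ip_e_e
  simp [he, ip, gProd] at this

variable {M}

theorem sub_smul_deficiencyVector {z : ℂ} (hz : ∀ x, M.B x = z • x → x = 0) :
    M.B (M.deficiencyVector z) - z • M.deficiencyVector z = M.B M.e + Complex.I • M.e := by
  have h := M.sub_invSub hz M.e
  simp only [deficiencyVector, LinearMap.add_apply, LinearMap.smul_apply, Module.End.one_apply]
  generalize M.invSub z M.e = u at h
  rw [← h]
  simp only [map_add, map_sub, map_smul]
  module

/-- The pair `(y, z y)` with `y = c (B + i)(B - z)⁻¹ e` has the symplectic coordinates `ξ₊ = c`,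
`ξ₋ = -c Q(z)`, and no others. -/
theorem hasInnerCoords_deficiencyVector {z : ℂ} (hz : ∀ x, M.B x = z • x → x = 0)
    (c ξp ξm : ℂ) :
    M.HasInnerCoords (c • M.deficiencyVector z) (z • c • M.deficiencyVector z) ξp ξm ↔
      ξp = c ∧ ξm = -(c * M.Q z) := by
  have hdef := sub_smul_deficiencyVector hz
  have h := M.sub_invSub hz M.e
  have h1 : M.B (c • M.deficiencyVector z) - z • c • M.deficiencyVector z =
      c • (M.B M.e + Complex.I • M.e) := by
    rw [← hdef, map_smul]
    module
  have h2 : M.B (c • M.deficiencyVector z) - Complex.I • c • M.deficiencyVector z - c • M.B M.e =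
      c • (M.invSub z M.e + z • M.B (M.invSub z M.e)) := by
    simp only [deficiencyVector, LinearMap.add_apply, LinearMap.smul_apply, Module.End.one_apply]
    generalize M.invSub z M.e = u at h
    have hI : (Complex.I * Complex.I) • c • u = -(c • u) := by
      rw [Complex.I_mul_I, neg_one_smul]
    rw [← h]
    simp only [map_add, map_sub, map_smul]
    linear_combination (norm := module) -hI
  rw [hasInnerCoords_iff, h1]
  constructor
  · rintro ⟨ha, hb⟩
    obtain rfl : c = ξp := M.eq_of_smul_add_I_smul_e ha
    refine ⟨rfl, ?_⟩
    rw [hb, h2, ip_smul_right]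
    simp [Q]
  · rintro ⟨rfl, rfl⟩
    refine ⟨rfl, ?_⟩
    rw [h2, ip_smul_right]
    simp [Q]

/-- For real `lam` the deficiency vector solves `B₀⁺ y = lam y`. -/
theorem innerAdjoint_deficiencyVector {lam : ℝ}
    (hz : ∀ x, M.B x = (lam : ℂ) • x → x = 0) (c : ℂ) :
    M.InnerAdjoint (c • M.deficiencyVector lam) ((lam : ℂ) • c • M.deficiencyVector lam) := by
  intro x hx
  rw [mem_restrictedDomain_iff, ip_sub_smul_left] at hx
  rw [ip_B, ← sub_eq_zero, ← ip_sub_right, map_smul, smul_comm (lam : ℂ) c, ← smul_sub,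
    sub_smul_deficiencyVector hz, ip_smul_right]
  rw [show M.B M.e + Complex.I • M.e = M.B M.e - conj Complex.I • M.e by
    rw [Complex.conj_I]; module, hx, mul_zero]

/-! ### The spectral formula for the `Q`-function -/

variable {N : ℕ} (b : OrthonormalBasis (Fin N) ℂ E) {μ : Fin N → ℝ}

theorem inner_eigenvector_B (hb : ∀ s, M.B (b s) = (μ s : ℂ) • b s) (s : Fin N) (x : E) :
    inner ℂ (b s) (M.B x) = μ s * inner ℂ (b s) x := by
  rw [← M.symm, hb, inner_smul_left, Complex.conj_ofReal]

theorem eq_zero_of_forall_ne_eigenvalue (hb : ∀ s, M.B (b s) = (μ s : ℂ) • b s) {z : ℂ}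
    (hz : ∀ s, z ≠ μ s) (x : E) (hx : M.B x = z • x) : x = 0 := by
  refine InnerProductSpace.ext_inner_left_basis b.toBasis fun s => ?_
  have h := inner_eigenvector_B b hb s x
  rw [hx, inner_smul_right] at h
  have h' : (z - μ s) * inner ℂ (b s) x = 0 := by rw [sub_mul, h, sub_self]
  simpa [sub_ne_zero.mpr (hz s)] using h'

/-- As the spectrum of `B` is simple, the metric, which commutes with `B`, is diagonal in the
eigenbasis of `B`. -/
theorem metricOp_eigenvector (hμ : Function.Injective μ)
    (hb : ∀ s, M.B (b s) = (μ s : ℂ) • b s) (s : Fin N) :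
    metricOp M.Eplus (b s) = M.ip (b s) (b s) • b s := by
  refine InnerProductSpace.ext_inner_left_basis b.toBasis fun t => ?_
  rw [OrthonormalBasis.coe_toBasis, inner_smul_right, b.inner_eq_ite]
  by_cases hts : t = s
  · subst hts
    simp [ip, gProd, metricOp_isSymmetric M.Eplus (b t) (b t)]
  · rw [if_neg hts, mul_zero]
    have h := inner_eigenvector_B b hb t (metricOp M.Eplus (b s))
    have hc : M.B (metricOp M.Eplus (b s)) = metricOp M.Eplus (M.B (b s)) :=
      LinearMap.congr_fun M.comm.eq (b s)
    rw [hc, hb, map_smul, inner_smul_right, ← sub_eq_zero, ← sub_mul] at h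
    rcases mul_eq_zero.mp h with h | h
    · exact absurd (hμ (by exact_mod_cast (sub_eq_zero.mp h).symm)) hts
    · exact h

theorem Q_eq_sum (hμ : Function.Injective μ) (hb : ∀ s, M.B (b s) = (μ s : ℂ) • b s) {z : ℂ}
    (hz : ∀ s, z ≠ μ s) :
    M.Q z = ∑ s, ((1 + z * μ s) / (μ s - z) : ℂ) * (‖inner ℂ (b s) M.e‖ ^ 2 : ℝ) *
      M.ip (b s) (b s) := by
  have hres := M.sub_invSub (eq_zero_of_forall_ne_eigenvalue b hb hz) M.e
  rw [Q, ip, gProd, ← b.sum_inner_mul_inner]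
  refine Finset.sum_congr rfl fun s _ => ?_
  have h1 : inner ℂ (metricOp M.Eplus M.e) (b s) = M.ip (b s) (b s) * conj (inner ℂ (b s) M.e) := by
    rw [metricOp_isSymmetric, metricOp_eigenvector b hμ hb, inner_smul_right, inner_conj_symm]
  have h2 : (μ s - z) * inner ℂ (b s) (M.invSub z M.e) = inner ℂ (b s) M.e := by
    conv_rhs => rw [← hres]
    rw [inner_sub_right, inner_eigenvector_B b hb, inner_smul_right, sub_mul]
  have h3 : inner ℂ (b s) (((1 : Module.End ℂ E) + z • M.B) (M.invSub z M.e)) =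
      (1 + z * μ s) * inner ℂ (b s) (M.invSub z M.e) := by
    simp only [LinearMap.add_apply, LinearMap.smul_apply, Module.End.one_apply, inner_add_right,
      inner_smul_right, inner_eigenvector_B b hb]
    ring
  have hne : (μ s : ℂ) - z ≠ 0 := sub_ne_zero.mpr (hz s).symm
  have hsq : ((‖inner ℂ (b s) M.e‖ ^ 2 : ℝ) : ℂ) = conj (inner ℂ (b s) M.e) * inner ℂ (b s) M.e := by
    rw [mul_comm, Complex.mul_conj, Complex.normSq_eq_norm_sq]
  rw [h1, h3, hsq]
  nth_rewrite 3 [← h2]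
  field_simp

theorem conj_Q (hμ : Function.Injective μ) (hb : ∀ s, M.B (b s) = (μ s : ℂ) • b s) {lam : ℝ}
    (hreg : ∀ s, lam ≠ μ s) : conj (M.Q lam) = M.Q lam := by
  rw [Q_eq_sum b hμ hb (fun s => by exact_mod_cast hreg s), map_sum]
  refine Finset.sum_congr rfl fun s _ => ?_
  simp only [map_mul, map_div₀, map_add, map_sub, map_one, Complex.conj_ofReal, ip_conj]

end InnerModel

/-! ### The boundary condition for the amplitudes -/

/-- Membership in the domains of the adjoints is automatic for the scattered wave, so that being
amplitudes amounts to the boundary condition for the unique boundary values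
`A = T`, `b = 1 + i√lam T / (4π)`, `ξ₊ = TE`, `ξ₋ = -TE Q(lam)`. -/
theorem InnerModel.areAmplitudes_iff {E : Type*} [NormedAddCommGroup E] [InnerProductSpace ℂ E]
    [FiniteDimensional ℂ E] {M : InnerModel E} {Γ : Matrix (Fin 2) (Fin 2) ℂ} {lam : ℝ}
    (hlam : 0 < lam) (hz : ∀ x, M.B x = (lam : ℂ) • x → x = 0) {ν : R3} (hν : ‖ν‖ = 1)
    (T TE : ℂ) :
    M.AreAmplitudes Γ lam ν T TE ↔
      1 + T * (Complex.I * (Real.sqrt lam / (4 * Real.pi) : ℝ)) = Γ 0 0 * T + Γ 0 1 * TE ∧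
        TE * M.Q lam = Γ 1 0 * T + Γ 1 1 * TE := by
  have hbv : ∀ χ : R3 → ℝ, (∀ᶠ x in 𝓝 0, χ x = 1) →
      HasOuterBoundaryValues (fun x => (χ x : ℂ) * outerWave lam ν T x) T
        (1 + T * (Complex.I * (Real.sqrt lam / (4 * Real.pi) : ℝ))) := by
    intro χ hχ
    refine (hasOuterBoundaryValues_outerWave lam ν T).congr ?_
    filter_upwards [hχ] with x hx
    simp [hx]
  have hmul : ∀ b ξm : ℂ, ![b, -ξm] = Γ.mulVec ![T, TE] ↔
      b = Γ 0 0 * T + Γ 0 1 * TE ∧ -ξm = Γ 1 0 * T + Γ 1 1 * TE := by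
    intro b ξm
    rw [funext_iff, Fin.forall_fin_two]
    simp [Matrix.mulVec, dotProduct, Fin.sum_univ_two]
  constructor
  · intro h
    let β : ContDiffBump (0 : R3) := ⟨1, 2, one_pos, one_lt_two⟩
    obtain ⟨f, ⟨-, -, A, b, ξp, ξm, hb, hc, hΓ⟩, -⟩ :=
      h β β.contDiff β.hasCompactSupport β.eventuallyEq_one
    obtain ⟨rfl, rfl⟩ := hb.unique (hbv β β.eventuallyEq_one)
    obtain ⟨rfl, rfl⟩ := (hasInnerCoords_deficiencyVector hz TE ξp ξm).mp hc
    simpa using (hmul _ _).mp hΓ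
  · intro h χ hχ hχc hχ1
    obtain ⟨f, hf, hloc⟩ := exists_outerAdjoint_outerWave hlam hν T hχ hχc hχ1
    refine ⟨f, ⟨hf, innerAdjoint_deficiencyVector hz TE, T, _, TE, _, hbv χ hχ1,
      (hasInnerCoords_deficiencyVector hz TE _ _).mpr ⟨rfl, rfl⟩, ?_⟩, hloc⟩
    rw [hmul]
    simpa using h

theorem theorem3p1 {E : Type*} [NormedAddCommGroup E] [InnerProductSpace ℂ E]
    [FiniteDimensional ℂ E] (M : InnerModel E)
    {N : ℕ} (b : OrthonormalBasis (Fin N) ℂ E) (μ : Fin N → ℝ) (hμ : Function.Injective μ)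
    (hb : ∀ s, M.B (b s) = (μ s : ℂ) • b s)
    (Γ : Matrix (Fin 2) (Fin 2) ℂ) (hΓ : Γ.IsHermitian)
    (lam : ℝ) (hlam : 0 < lam) (hreg : ∀ s, lam ≠ μ s) :
    M.Q lam = ∑ s, ((1 + lam * μ s) / (μ s - lam) : ℂ) * (‖inner ℂ (b s) M.e‖ ^ 2 : ℝ) *
        M.ip (b s) (b s) ∧
    (M.Q lam ≠ Γ 1 1 →
      ∀ ν : R3, ‖ν‖ = 1 → ∀ T TE : ℂ,
        M.AreAmplitudes Γ lam ν T TE ↔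
          T = 1 / (Γ 0 0 - (‖Γ 0 1‖ ^ 2 : ℝ) / (Γ 1 1 - M.Q lam)
              - Complex.I * (Real.sqrt lam / (4 * Real.pi) : ℝ)) ∧
          TE = Γ 1 0 / (M.Q lam - Γ 1 1) * T) := by
  have hreg' : ∀ s, (lam : ℂ) ≠ μ s := fun s => by exact_mod_cast hreg s
  refine ⟨InnerModel.Q_eq_sum b hμ hb hreg', fun hQ ν hν T TE => ?_⟩
  rw [InnerModel.areAmplitudes_iff hlam
    (InnerModel.eq_zero_of_forall_ne_eigenvalue b hb hreg') hν]
  set κ : ℝ := Real.sqrt lam / (4 * Real.pi)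
  have hκ : κ ≠ 0 := by
    have := Real.sqrt_pos.mpr hlam
    have := Real.pi_pos
    positivity
  have hQc : conj (M.Q lam) = M.Q lam := InnerModel.conj_Q b hμ hb hreg
  have hΓ00 : conj (Γ 0 0) = Γ 0 0 := hΓ.apply 0 0
  have hΓ11 : conj (Γ 1 1) = Γ 1 1 := hΓ.apply 1 1
  have hΓ01 : ((‖Γ 0 1‖ ^ 2 : ℝ) : ℂ) = Γ 0 1 * Γ 1 0 := by
    have h10 : conj (Γ 0 1) = Γ 1 0 := hΓ.apply 1 0
    rw [← h10, Complex.mul_conj, Complex.normSq_eq_norm_sq]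
  have h1 : M.Q lam - Γ 1 1 ≠ 0 := sub_ne_zero.mpr hQ
  have h2 : Γ 1 1 - M.Q lam ≠ 0 := sub_ne_zero.mpr hQ.symm
  -- The denominator of `T` is a real number minus the nonzero imaginary number `iκ`.
  have hD : Γ 0 0 - (‖Γ 0 1‖ ^ 2 : ℝ) / (Γ 1 1 - M.Q lam) - Complex.I * κ ≠ 0 := by
    intro h0
    have hc := congrArg conj h0
    simp only [map_sub, map_mul, map_div₀, Complex.conj_ofReal, Complex.conj_I, hΓ00, hΓ11, hQc,
      map_zero] at hc
    have : Complex.I * (κ : ℂ) = 0 := by linear_combination (hc - h0) / 2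
    simp [hκ] at this
  have hTE : TE * M.Q lam = Γ 1 0 * T + Γ 1 1 * TE ↔ TE = Γ 1 0 / (M.Q lam - Γ 1 1) * T := by
    rw [div_mul_eq_mul_div, eq_div_iff h1]
    constructor <;> intro h <;> linear_combination h
  rw [hTE, eq_div_iff hD, hΓ01]
  refine and_congr_left fun h => ?_
  have hsub : Γ 0 1 * TE = -(Γ 0 1 * Γ 1 0 / (Γ 1 1 - M.Q lam)) * T := by
    rw [h, ← neg_sub (Γ 1 1), div_neg]
    ring
  rw [hsub]
  constructor <;> intro h' <;> linear_combination -h'
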